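/- Let $\mathbb{T}$ be the unit circle, $\mathbb{D}$ the open unit disc, $\mathcal{M}_{\mathbb{T}}$ the set of Borel probability measures on $\mathbb{T}$, and $m$ the normalized Haar measure on $\mathbb{T}$. Let $A$ be a unital complex algebra with two linear functionals $\varphi,\psi:A\to\mathbb{C}$ such that $\varphi(1)=\psi(1)=1$. Elements $X,Y\in A$ are called conditionally free if, writing $A_1$ and $A_2$ for the unital subalgebras generated by $X$ and by $Y$, one has $$\psi(a_1\cdots a_n)=0\quad\text{and}\quad \varphi(a_1\cdots a_n)=\varphi(a_1)\cdots\varphi(a_n)$$ whenever $n\ge 1$, $a_j\in A_{\varepsilon(j)}$, $\varepsilon(j)\in\{1,2\}$, $\varepsilon(1)\ne\varepsilon(2)\ne\cdots\ne\varepsilon(n)$ and $\psi(a_j)=0$ for all $j$. An element $X$ has the pair of distributions $(\mu,\nu)\in\mathcal{M}_{\mathbb{T}}\times\mathcal{M}_{\mathbb{T}}$ if $\varphi(X^k)=\int_{\mathbb{T}}\zeta^k\,d\mu(\zeta)$ and $\psi(X^k)=\int_{\mathbb{T}}\zeta^k\,d\nu(\zeta)$ for all $k\ge 0$. The multiplicative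 conditionally free convolution $(\mu_1,\nu_1)\boxtimes(\mu_2,\nu_2)\in\mathcal{M}_{\mathbb{T}}\times\mathcal{M}_{\mathbb{T}}$ is the pair of distributions of $XY$, where $X$ and $Y$ are conditionally free with pairs of distributions $(\mu_1,\nu_1)$ and $(\mu_2,\nu_2)$. A pair $(\mu,\nu)\in\mathcal{M}_{\mathbb{T}}\times\mathcal{M}_{\mathbb{T}}$ is $\boxtimes$-infinitely divisible if for every integer $n\ge 1$ there is a pair $(\mu_n,\nu_n)\in\mathcal{M}_{\mathbb{T}}\times\mathcal{M}_{\mathbb{T}}$ with $$(\mu,\nu)=\underbrace{(\mu_n,\nu_n)\boxtimes\cdots\boxtimes(\mu_n,\nu_n)}_{n\text{ times}}.$$ Proposition. Let $\mu\in\mathcal{M}_{\mathbb{T}}$ be such that the pair $(\mu,m)$ is $\boxtimes$-infinitely divisible and $\int_{\mathbb{T}}\zeta\,d\mu(\zeta)\ne 0$. Then either $\mu=\delta_\lambda$ is a point mass at some $\lambda\in\mathbb{T}$, or $\mu$ is the harmonic measure for the unit disc relative to some point $\alpha\in\mathbb{D}\setminus\{0\}$, that is, $d\mu=P_\alpha\,dm$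 with the Poisson kernel $P_\alpha(\zeta)=\dfrac{1-|\alpha|^2}{|\zeta-\alpha|^2}$, $\zeta\in\mathbb{T}$. -/

import Mathlib

open MeasureTheory

namespace CFree

noncomputable instance instMeasurableSpaceCircle : MeasurableSpace Circle := borel Circle

instance instBorelSpaceCircle : BorelSpace Circle := ⟨rfl⟩

/-- Conditional freeness of a family of unital subalgebras `S i` of `A` with respect to the pair of
functionals `(φ, ψ)`: for every nonempty word `a₁ ⋯ aₙ` with `aⱼ ∈ S (ε j)`, consecutive indices
`ε j ≠ ε (j + 1)` and `ψ aⱼ = 0`, one has `ψ (a₁ ⋯ aₙ) = 0` and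
`φ (a₁ ⋯ aₙ) = φ a₁ ⋯ φ aₙ`. A word is a list of pairs `(ε j, aⱼ)`. -/
def IsCFree {ι A : Type*} [Ring A] [Algebra ℂ A] (φ ψ : A →ₗ[ℂ] ℂ)
    (S : ι → Subalgebra ℂ A) : Prop :=
  ∀ w : List (ι × A), w ≠ [] →
    (∀ p ∈ w, p.2 ∈ S p.1 ∧ ψ p.2 = 0) →
    w.IsChain (fun p q => p.1 ≠ q.1) →
    ψ (w.map fun p => p.2).prod = 0 ∧
      φ (w.map fun p => p.2).prod = (w.map fun p => φ p.2).prod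

/-- The elements `x` and `y` are conditionally free: the unital subalgebras that they generate
are. -/
def IsCFreeElements {A : Type*} [Ring A] [Algebra ℂ A] (φ ψ : A →ₗ[ℂ] ℂ) (x y : A) : Prop :=
  IsCFree φ ψ fun i : Fin 2 => Algebra.adjoin ℂ {![x, y] i}

/-- The probability measure `μ` on the unit circle is the distribution of `x` with respect to the
functional `φ`: the moments `φ (xᵏ)` are those of `μ`. (A probability measure on the circle is
determined by its moments of nonnegative order, the others being their complex conjugates.) -/
def HasDistribution {A : Type*} [Ring A] [Algebra ℂ A] (φ : A →ₗ[ℂ] ℂ) (x : A)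
    (μ : ProbabilityMeasure Circle) : Prop :=
  ∀ k : ℕ, φ (x ^ k) = ∫ ζ : Circle, (ζ : ℂ) ^ k ∂(μ : Measure Circle)

/-- `IsConv p q r` means `r = p ⊠ q`, the multiplicative conditionally free convolution of pairs of
probability measures on the unit circle: `r` is the pair of distributions, with respect to `φ` and
`ψ`, of the product `x * y` of two elements that are conditionally free with respect to the
normalized functionals `(φ, ψ)` and have the pairs of distributions `p` and `q`. -/
def IsConv (p q r : ProbabilityMeasure Circle × ProbabilityMeasure Circle) : Prop :=
  ∃ (A : Type) (_ : Ring A) (_ : Algebra ℂ A) (φ ψ : A →ₗ[ℂ] ℂ) (x y : A),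
    φ 1 = 1 ∧ ψ 1 = 1 ∧ IsCFreeElements φ ψ x y ∧
    HasDistribution φ x p.1 ∧ HasDistribution ψ x p.2 ∧
    HasDistribution φ y q.1 ∧ HasDistribution ψ y q.2 ∧
    HasDistribution φ (x * y) r.1 ∧ HasDistribution ψ (x * y) r.2

/-- `IsConvPow p n r` means `r = p ⊠ ⋯ ⊠ p` with `n + 1` factors. -/
def IsConvPow (p : ProbabilityMeasure Circle × ProbabilityMeasure Circle) :
    ℕ → ProbabilityMeasure Circle × ProbabilityMeasure Circle → Prop
  | 0, r => r = p
  | n + 1, r => ∃ s, IsConvPow p n s ∧ IsConv s p r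

/-- The pair `r` is `⊠`-infinitely divisible: for each number `n + 1` of factors it is a
convolution power `p ⊠ ⋯ ⊠ p`. -/
def IsInfinitelyDivisible (r : ProbabilityMeasure Circle × ProbabilityMeasure Circle) : Prop :=
  ∀ n : ℕ, ∃ p, IsConvPow p n r

/-- The normalized Haar measure on the unit circle. -/
noncomputable def haarCircle : ProbabilityMeasure Circle :=
  ⟨Measure.haarMeasure ⊤, ⟨by
    simpa using Measure.haarMeasure_self (K₀ := (⊤ : TopologicalSpace.PositiveCompacts Circle))⟩⟩

end CFree

namespace CFree

open scoped ComplexConjugate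

/-! Square roots alone suffice. If `(μ, m) = p ⊠ p` is realised by `x` and `y`, then `ψ x = ψ y` and
`ψ x * ψ y = ψ (x * y) = 0`, so both are `ψ`-centred. Hence `(x * y) ^ k` is an alternating centred
word, `φ` is multiplicative on it, and the moments of `μ` are `c ^ k` with `c` the first moment
(`IsConv.integral_pow_eq`). These are the moments of a point mass if `‖c‖ = 1` and of harmonic
measure at `c` if `‖c‖ < 1`; `measure_ext_of_moments` concludes. -/

/-- Finite measures on the circle that have the same moments of nonnegative order are equal. -/
theorem measure_ext_of_moments {P Q : Measure Circle} [IsFiniteMeasure P] [IsFiniteMeasure Q]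
    (h : ∀ k : ℕ, ∫ ζ : Circle, (ζ : ℂ) ^ k ∂P = ∫ ζ : Circle, (ζ : ℂ) ^ k ∂Q) : P = Q := by
  have hz : ∀ n : ℤ, ∫ ζ : Circle, (ζ : ℂ) ^ n ∂P = ∫ ζ : Circle, (ζ : ℂ) ^ n ∂Q := by
    intro n
    obtain ⟨k, rfl | rfl⟩ := n.eq_nat_or_neg
    · simpa using h k
    · have hc : ∀ ζ : Circle, (ζ : ℂ) ^ (-(k : ℤ)) = conj ((ζ : ℂ) ^ k) := by
        intro ζ
        rw [zpow_neg, zpow_natCast, map_pow, ← Circle.coe_inv_eq_conj, Circle.coe_inv, inv_pow]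
      simp only [hc, integral_conj, h k]
  let g : BoundedContinuousFunction Circle ℂ :=
    BoundedContinuousFunction.mkOfCompact ⟨fun ζ : Circle => (ζ : ℂ), by fun_prop⟩
  -- The star algebra generated by the coordinate function separates points and is spanned by the
  -- integer powers `ζ ^ n`.
  refine ext_of_forall_mem_subalgebra_integral_eq_of_pseudoEMetric_complete_countable
    (𝕜 := ℂ) (A := StarAlgebra.adjoin ℂ {g}) ?_ ?_
  · intro x y hxy
    refine ⟨fun ζ => (ζ : ℂ), ⟨_, ⟨g, StarAlgebra.self_mem_adjoin_singleton ℂ g, rfl⟩, rfl⟩, ?_⟩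
    exact fun hxy' => hxy (Circle.ext hxy')
  · intro f hf
    rw [← StarSubalgebra.mem_toSubalgebra, StarAlgebra.adjoin_toSubalgebra,
      ← Subalgebra.mem_toSubmodule, Algebra.adjoin_eq_span] at hf
    induction hf using Submodule.span_induction with
    | mem f hf =>
      obtain ⟨n, hn⟩ : ∃ n : ℤ, ∀ ζ : Circle, f ζ = (ζ : ℂ) ^ n := by
        induction hf using Submonoid.closure_induction with
        | mem f hf =>
          rcases hf with hf | hf
          · rw [Set.mem_singleton_iff] at hf
            exact ⟨1, fun ζ => by rw [hf, zpow_one]; rfl⟩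
          · rw [Set.mem_star, Set.mem_singleton_iff] at hf
            refine ⟨-1, fun ζ => ?_⟩
            rw [← star_star f, hf, zpow_neg_one, ← Circle.coe_inv, Circle.coe_inv_eq_conj]
            rfl
        | one => exact ⟨0, fun ζ => by simp⟩
        | mul f₁ f₂ _ _ h₁ h₂ =>
          obtain ⟨n₁, h₁⟩ := h₁
          obtain ⟨n₂, h₂⟩ := h₂
          exact ⟨n₁ + n₂, fun ζ => by
            rw [BoundedContinuousFunction.mul_apply, h₁, h₂, zpow_add₀ ζ.coe_ne_zero]⟩
      simpa only [hn] using hz n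
    | zero => simp
    | add f₁ f₂ _ _ h₁ h₂ =>
      simp only [BoundedContinuousFunction.add_apply]
      rw [integral_add (f₁.integrable P) (f₂.integrable P),
        integral_add (f₁.integrable Q) (f₂.integrable Q), h₁, h₂]
    | smul a f _ h₁ =>
      simp only [BoundedContinuousFunction.smul_apply, integral_smul, h₁]

/-- The normalized Haar measure has vanishing moments of positive order. -/
theorem integral_pow_haarCircle {k : ℕ} (hk : k ≠ 0) :
    ∫ ζ : Circle, (ζ : ℂ) ^ k ∂(haarCircle : Measure Circle) = 0 := by
  have : (haarCircle : Measure Circle).IsHaarMeasure :=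
    inferInstanceAs (Measure.haarMeasure ⊤).IsHaarMeasure
  have hinv := fun w : Circle =>
    integral_mul_left_eq_self (μ := (haarCircle : Measure Circle)) (fun ζ => (ζ : ℂ) ^ k) w
  -- As `w ^ k = -1`, rotating by `w` changes the sign of the moment, while invariance preserves it.
  set w : Circle := Circle.exp (Real.pi / k) with hw
  have hwk : (w : ℂ) ^ k = -1 := by
    have hk' : (k : ℂ) ≠ 0 := Nat.cast_ne_zero.2 hk
    rw [hw, Circle.coe_exp, ← Complex.exp_nat_mul, ← Complex.exp_pi_mul_I]
    congr 1
    push_cast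
    field_simp
  have h := hinv w
  simp only [Circle.coe_mul, mul_pow, hwk, integral_const_mul] at h
  linear_combination -h / 2

/-- Integration against the normalized Haar measure is the average over the unit circle. -/
theorem integral_haarCircle_eq_circleAverage {f : ℂ → ℂ}
    (hf : Continuous fun ζ : Circle => f ζ) :
    ∫ ζ : Circle, f ζ ∂(haarCircle : Measure Circle) = Real.circleAverage f 0 1 := by
  have hpi : (0 : ℝ) < 2 * Real.pi := Real.two_pi_pos
  let σ : Measure Circle :=
    (ENNReal.ofReal (2 * Real.pi)⁻¹ • volume.restrict (Set.Ioc 0 (2 * Real.pi))).map Circle.exp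
  have hσ : ∀ g : ℂ → ℂ, (Continuous fun ζ : Circle => g ζ) →
      ∫ ζ : Circle, g ζ ∂σ = Real.circleAverage g 0 1 := by
    intro g hg
    rw [integral_map Circle.exp.continuous.aemeasurable hg.aestronglyMeasurable,
      integral_smul_measure, ENNReal.toReal_ofReal (by positivity), Real.circleAverage_def,
      intervalIntegral.integral_of_le hpi.le]
    simp [circleMap]
  have : IsFiniteMeasure σ := by
    have : IsFiniteMeasure
        (ENNReal.ofReal (2 * Real.pi)⁻¹ • volume.restrict (Set.Ioc 0 (2 * Real.pi))) :=
      Measure.smul_finite _ ENNReal.ofReal_ne_top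
    infer_instance
  have hm : (haarCircle : Measure Circle) = σ := by
    refine measure_ext_of_moments fun k => ?_
    rw [hσ (fun z => z ^ k) (by fun_prop)]
    -- Mean value property: the average of `z ^ k` is its value at `0`.
    rw [((Differentiable.diffContOnCl (by fun_prop)) :
      DiffContOnCl ℂ (fun z : ℂ => z ^ k) (Metric.ball 0 |1|)).circleAverage]
    rcases eq_or_ne k 0 with rfl | hk
    · simp
    · rw [integral_pow_haarCircle hk, zero_pow hk]
  rw [hm, hσ f hf]

theorem continuous_poissonKernel_circle {α : ℂ} (hα : ‖α‖ < 1) :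
    Continuous fun ζ : Circle => poissonKernel 0 α (ζ : ℂ) := by
  simp only [poissonKernel_def]
  refine Continuous.div (by fun_prop) (by fun_prop) fun ζ h => ?_
  have h' : (ζ : ℂ) = α := by simpa [sub_eq_zero] using h
  exact hα.ne (by rw [← h', Circle.norm_coe])

theorem poissonKernel_circle_nonneg {α : ℂ} (hα : ‖α‖ < 1) (ζ : Circle) :
    0 ≤ poissonKernel 0 α (ζ : ℂ) := by
  simp only [poissonKernel_def, sub_zero, Circle.norm_coe]
  have := norm_nonneg α
  exact div_nonneg (by nlinarith) (by positivity)

/-- The moments of the harmonic measure relative to `α` are the powers of `α`. -/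
theorem integral_pow_withDensity_poissonKernel {α : ℂ} (hα : ‖α‖ < 1) (k : ℕ) :
    ∫ ζ : Circle, (ζ : ℂ) ^ k ∂(haarCircle : Measure Circle).withDensity
      (fun ζ => ENNReal.ofReal (poissonKernel 0 α (ζ : ℂ))) = α ^ k := by
  have hc := continuous_poissonKernel_circle hα
  rw [integral_withDensity_eq_integral_toReal_smul hc.measurable.ennreal_ofReal
    (by simp)]
  simp only [ENNReal.toReal_ofReal (poissonKernel_circle_nonneg hα _)]
  have hd : DiffContOnCl ℂ (fun z : ℂ => z ^ k) (Metric.ball 0 1) :=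
    Differentiable.diffContOnCl (by fun_prop)
  -- The Poisson integral reproduces the holomorphic function `z ^ k` at `α`.
  have h := hd.circleAverage_poissonKernel_smul (w := α) (by simpa using hα)
  rw [← integral_haarCircle_eq_circleAverage (hc.smul (by fun_prop))] at h
  exact h

/-- If `x` and `y` are conditionally free, then `ψ (x y) = ψ x ψ y`. -/
theorem IsCFreeElements.psi_mul {A : Type*} [Ring A] [Algebra ℂ A] {φ ψ : A →ₗ[ℂ] ℂ} {x y : A}
    (h : IsCFreeElements φ ψ x y) (hψ : ψ 1 = 1) : ψ (x * y) = ψ x * ψ y := by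
  have hmem : ∀ (i : Fin 2) (c : ℂ),
      ![x, y] i - algebraMap ℂ A c ∈ Algebra.adjoin ℂ {![x, y] i} := fun i c =>
    sub_mem (Algebra.self_mem_adjoin_singleton ℂ _) (Subalgebra.algebraMap_mem _ c)
  have hcen : ∀ a : A, ψ (a - algebraMap ℂ A (ψ a)) = 0 := fun a => by
    simp [Algebra.algebraMap_eq_smul_one, hψ]
  have h0 := (h [(0, x - algebraMap ℂ A (ψ x)), (1, y - algebraMap ℂ A (ψ y))] (by simp)
    (by
      intro p hp
      simp only [List.mem_cons, List.not_mem_nil, or_false] at hp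
      rcases hp with rfl | rfl
      · exact ⟨hmem 0 _, hcen x⟩
      · exact ⟨hmem 1 _, hcen y⟩) (by simp)).1
  simp only [List.map_cons, List.map_nil, List.prod_cons, List.prod_nil, mul_one,
    Algebra.algebraMap_eq_smul_one, sub_mul, mul_sub, smul_mul_assoc, mul_smul_comm, one_mul,
    map_sub, map_smul, hψ, smul_eq_mul] at h0
  linear_combination h0

/-- If `x` and `y` are conditionally free and `ψ`-centred, then `φ` is multiplicative on the
powers of `x y`. -/
theorem IsCFreeElements.phi_mul_pow {A : Type*} [Ring A] [Algebra ℂ A] {φ ψ : A →ₗ[ℂ] ℂ}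
    {x y : A} (h : IsCFreeElements φ ψ x y) (hφ : φ 1 = 1) (hx : ψ x = 0) (hy : ψ y = 0) (k : ℕ) :
    φ ((x * y) ^ k) = (φ x * φ y) ^ k := by
  -- `w n` is the word `x y x y ⋯ x y` with `n` blocks.
  obtain ⟨w, hw0, hw⟩ : ∃ w : ℕ → List (Fin 2 × A),
      w 0 = [] ∧ ∀ n, w (n + 1) = (0, x) :: (1, y) :: w n :=
    ⟨fun n => n.rec [] fun _ l => (0, x) :: (1, y) :: l, rfl, fun _ => rfl⟩
  have hprod : ∀ n, ((w n).map fun p => p.2).prod = (x * y) ^ n := by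
    intro n
    induction n with
    | zero => simp [hw0]
    | succ n ih => simp [hw, ih, pow_succ', mul_assoc]
  have hprod' : ∀ n, ((w n).map fun p => φ p.2).prod = (φ x * φ y) ^ n := by
    intro n
    induction n with
    | zero => simp [hw0]
    | succ n ih => simp [hw, ih, pow_succ', mul_assoc]
  have hmem : ∀ n, ∀ p ∈ w n, p.2 ∈ Algebra.adjoin ℂ {![x, y] p.1} ∧ ψ p.2 = 0 := by
    intro n
    induction n with
    | zero => simp [hw0]
    | succ n ih =>
      intro p hp
      rw [hw, List.mem_cons, List.mem_cons] at hp
      rcases hp with rfl | rfl | hp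
      · exact ⟨Algebra.self_mem_adjoin_singleton ℂ x, hx⟩
      · exact ⟨Algebra.self_mem_adjoin_singleton ℂ y, hy⟩
      · exact ih p hp
  have hchain : ∀ n, (w n).IsChain fun p q => p.1 ≠ q.1 := by
    intro n
    induction n with
    | zero => simp [hw0]
    | succ n ih =>
      -- The junction from `y` to the next `x` appears only once the following block is unfolded.
      cases n with
      | zero => simp [hw, hw0]
      | succ n =>
        rw [hw] at ih
        rw [hw, hw]
        simpa using ih
  -- Conditional freeness says nothing about the empty word.
  cases k with
  | zero => simp [hφ]
  | succ n =>
    rw [← hprod, ← hprod']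
    exact (h (w (n + 1)) (by simp [hw]) (hmem (n + 1)) (hchain (n + 1))).2

/-- If `(μ, m)` is a convolution square, then `μ` has the moments `1, c, c², …`. -/
theorem IsConv.integral_pow_eq {μ : ProbabilityMeasure Circle}
    {p : ProbabilityMeasure Circle × ProbabilityMeasure Circle}
    (h : IsConv p p (μ, haarCircle)) (k : ℕ) :
    ∫ ζ : Circle, (ζ : ℂ) ^ k ∂(μ : Measure Circle) =
      (∫ ζ : Circle, (ζ : ℂ) ∂(μ : Measure Circle)) ^ k := by
  obtain ⟨A, _, _, φ, ψ, x, y, hφ, hψ, hfree, -, hx, -, hy, hxy, hxy'⟩ := h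
  have hxy0 : ψ x = ψ y := by simpa using (hx 1).trans (hy 1).symm
  have hmul : ψ x * ψ y = 0 := by
    rw [← hfree.psi_mul hψ]
    simpa using (hxy' 1).trans (integral_pow_haarCircle one_ne_zero)
  have hy0 : ψ y = 0 := by simpa [hxy0] using hmul
  have key := hfree.phi_mul_pow hφ (hxy0.trans hy0) hy0
  have h1 := hxy 1
  rw [key 1] at h1
  simp only [pow_one] at h1
  rw [← h1, ← key k, hxy k]

end CFree

theorem mainTheorem11 (μ : ProbabilityMeasure Circle)
    (hdiv : CFree.IsInfinitelyDivisible (μ, CFree.haarCircle))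
    (hμ : (∫ ζ : Circle, (ζ : ℂ) ∂(μ : Measure Circle)) ≠ 0) :
    (∃ z : Circle, (μ : Measure Circle) = Measure.dirac z) ∨
      ∃ α : ℂ, ‖α‖ < 1 ∧ α ≠ 0 ∧
        (μ : Measure Circle) = (CFree.haarCircle : Measure Circle).withDensity
          (fun ζ => ENNReal.ofReal (poissonKernel 0 α (ζ : ℂ))) := by
  -- Index `1` means two factors.
  obtain ⟨p, s, hs, hconv⟩ := hdiv 1
  obtain rfl : s = p := hs
  have hmom := hconv.integral_pow_eq
  set c : ℂ := ∫ ζ : Circle, (ζ : ℂ) ∂(μ : Measure Circle) with hc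
  have hle : ‖c‖ ≤ 1 := by
    refine (norm_integral_le_of_norm_le_const (C := 1) ?_).trans (by simp)
    exact Filter.Eventually.of_forall fun ζ => ζ.norm_coe.le
  rcases hle.eq_or_lt with h1 | h1
  · obtain ⟨z, hz⟩ : ∃ z : Circle, (z : ℂ) = c := ⟨⟨c, mem_sphere_zero_iff_norm.2 h1⟩, rfl⟩
    refine Or.inl ⟨z, CFree.measure_ext_of_moments fun k => ?_⟩
    rw [hmom, integral_dirac, hz]
  · refine Or.inr ⟨c, h1, hμ, ?_⟩
    have : IsFiniteMeasure ((CFree.haarCircle : Measure Circle).withDensity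
        fun ζ => ENNReal.ofReal (poissonKernel 0 c (ζ : ℂ))) := by
      refine isFiniteMeasure_withDensity_ofReal ?_
      exact ((BoundedContinuousFunction.mkOfCompact
        ⟨_, CFree.continuous_poissonKernel_circle h1⟩).integrable _).2
    refine CFree.measure_ext_of_moments fun k => ?_
    rw [hmom, CFree.integral_pow_withDensity_poissonKernel h1]
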